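/- For a rational number $a/q\in(0,1]$ in lowest terms let $\bar a$ be the multiplicative inverse of $a$ modulo $q$ with $1\le \bar a<q$ (for $q=1$ put $\bar a=1$). For every integer $Q\ge 3$ let $\mathfrak{SF}_Q=\{a/q\in\mathbb{Q}\cap(0,1] : q+a+\bar a\le Q\}$ (fractions in lowest terms), and let $\mathscr{D}_Q$ be the set of pairs $(q_1,q_2)$ of denominators of consecutive elements $a_1/q_1<a_2/q_2$ of $\mathfrak{SF}_Q$. Put $\mathscr{D}=\bigcup_{Q\ge 3}Q^{-1}\mathscr{D}_Q\subseteq\mathbb{R}^2$ and $$\mathcal V=\Big\{(x,y)\in[0,1]^2 : \max\Big\{\frac{1-3x}{2},\,2x-1\Big\}\le y\le\max\{x,1-x\}\Big\}.$$ Then $\mathscr{D}$ is a dense subset of $\mathcal V$: one has $\mathscr{D}\subseteq\mathcal V$ (that is, $\mathscr{D}_Q\subseteq Q\mathcal V$ for every $Q\ge 3$), and $\mathcal V$ is contained in the closure of $\mathscr{D}$. -/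

import Mathlib

/-- The representative of the multiplicative inverse of `a` modulo `q` that lies in `[1, q)`;
for `q = 1`, where that interval is empty, it is the positive representative `1`. -/
def modInv (a : ℤ) (q : ℕ) : ℕ :=
  if q = 1 then 1 else ((a : ZMod q)⁻¹).val

/-- The height `h (a / q) = q + a + ā` of a fraction `a / q` in lowest terms. -/
def fracHeight (r : ℚ) : ℤ :=
  r.den + r.num + modInv r.num r.den

/-- The `SL(2, ℕ)`-saturated Farey fractions of order `Q`. -/
def saturatedFarey (Q : ℕ) : Set ℚ :=
  {r | 0 < r ∧ r ≤ 1 ∧ fracHeight r ≤ Q}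

/-- Pairs `(q₁, q₂)` of denominators of consecutive elements `a₁ / q₁ < a₂ / q₂` of
`saturatedFarey Q`. -/
def denomPairs (Q : ℕ) : Set (ℕ × ℕ) :=
  {p | ∃ r₁ ∈ saturatedFarey Q, ∃ r₂ ∈ saturatedFarey Q, r₁ < r₂ ∧
    (∀ s ∈ saturatedFarey Q, ¬ (r₁ < s ∧ s < r₂)) ∧ p = (r₁.den, r₂.den)}

/-- The union over `Q ≥ 3` of the scaled sets `Q⁻¹ • denomPairs Q`. -/
def scaledDenomPairs : Set (ℝ × ℝ) :=
  {z | ∃ Q : ℕ, 3 ≤ Q ∧ ∃ p ∈ denomPairs Q, z = ((p.1 : ℝ) / Q, (p.2 : ℝ) / Q)}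

/-- The region `max {(1 - 3x)/2, 2x - 1} ≤ y ≤ max {x, 1 - x}` of the unit square. -/
def regionV : Set (ℝ × ℝ) :=
  {z | z.1 ∈ Set.Icc (0 : ℝ) 1 ∧ z.2 ∈ Set.Icc (0 : ℝ) 1 ∧
    max ((1 - 3 * z.1) / 2) (2 * z.1 - 1) ≤ z.2 ∧ z.2 ≤ max z.1 (1 - z.1)}

open Filter Topology

/-! If `a * b - q * k = 1` with `b` the inverse of `a` and `q > 1`, then `a / q` is the mediant of
its parents `k / b` and `(a - k) / (q - b)`, whose heights are no larger. So between consecutive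
fractions there lies neither the left parent of the larger nor the right parent of the smaller; this
forces determinant 1 and makes one a parent of the other (`consecutive_spec`). All inverses are then
linear in the denominators: both heights are at most `Q`, while the mediant, with inverse `q₁`, has
height `2q₁ + q₂ + a₁ + a₂ > Q`. Eliminating the numerators by `0 < a ≤ q` leaves the inequalities
of `regionV`. Conversely, these height conditions suffice for Farey neighbours
(`mem_denomPairs_of_det`). For rational `(x, y)` inside the region and off the diagonal, some common
slope `t` in `(0, 1)` satisfies them strictly in the limit, and Farey neighbours with that limiting
shape exist (`exists_neighbours_tendsto`). -/

theorem exists_modInv_spec (r : ℚ) : ∃ b k : ℤ, 0 < b ∧ b ≤ r.den ∧ r.num * b - r.den * k = 1 ∧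
    fracHeight r = r.den + r.num + b ∧ ∀ c l : ℤ, 0 < c → r.num * c - r.den * l = 1 → b ≤ c := by
  have hq := r.den_pos
  by_cases h1 : r.den = 1
  · refine ⟨1, r.num - 1, one_pos, by simp [h1], by simp [h1], by simp [fracHeight, modInv, h1], ?_⟩
    intro c l hc _
    exact hc
  · have hne : NeZero r.den := ⟨hq.ne'⟩
    have hf : Fact (1 < r.den) := ⟨by omega⟩
    have hcop : IsCoprime r.num (r.den : ℤ) := by
      rw [Int.isCoprime_iff_nat_coprime]; simpa using r.reduced
    have hu : IsUnit (r.num : ZMod r.den) := (ZMod.coe_int_isUnit_iff_isCoprime _ _).2 hcop.symm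
    have hmul : (r.num : ZMod r.den) * (r.num : ZMod r.den)⁻¹ = 1 := ZMod.mul_inv_of_unit _ hu
    set v := (r.num : ZMod r.den)⁻¹ with hv
    have hv0 : v ≠ 0 := by
      intro h
      rw [h, mul_zero] at hmul
      exact zero_ne_one hmul
    have hcast : ((v.val : ℤ) : ZMod r.den) = v := by simp
    have hd : (r.den : ℤ) ∣ r.num * v.val - 1 := by
      rw [← ZMod.intCast_zmod_eq_zero_iff_dvd]
      push_cast
      simp [hmul]
    obtain ⟨k, hk⟩ := hd
    refine ⟨v.val, k, ?_, ?_, by linarith, by simp [fracHeight, modInv, h1, hv], ?_⟩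
    · have : v.val ≠ 0 := by simpa using hv0
      omega
    · exact_mod_cast (ZMod.val_lt v).le
    · intro c l hc h
      have hcv : (c : ZMod r.den) = v := by
        have h2 : (r.num : ZMod r.den) * c = 1 := by
          have := congrArg (Int.cast : ℤ → ZMod r.den) h
          push_cast at this
          simpa using this
        calc (c : ZMod r.den) = (r.num * v) * c := by rw [hmul, one_mul]
          _ = (r.num * c) * v := by ring
          _ = v := by rw [h2, one_mul]
      rw [← hcv, ZMod.val_intCast]
      lift c to ℕ using hc.le
      exact_mod_cast Nat.mod_le c r.den

/-! ### Determinant-one criteria and parents. -/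

theorem num_den_of_det {a q b k : ℤ} (hq : 0 < q) (h : a * b - q * k = 1) :
    ((a / q : ℚ)).num = a ∧ (((a / q : ℚ)).den : ℤ) = q := by
  have hc : Nat.Coprime a.natAbs q.natAbs :=
    Int.isCoprime_iff_nat_coprime.1 ⟨b, -k, by linarith⟩
  exact ⟨Rat.num_div_eq_of_coprime hq hc, Rat.den_div_eq_of_coprime hq hc⟩

/-- The true inverse is the least positive solution, so any positive `b` bounds the height from
above. -/
theorem mem_saturatedFarey_of_det {a q b k : ℤ} {Q : ℕ} (ha : 0 < a) (haq : a ≤ q) (hb : 0 < b)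
    (h : a * b - q * k = 1) (hQ : q + a + b ≤ Q) : (a / q : ℚ) ∈ saturatedFarey Q := by
  have hq : 0 < q := by omega
  obtain ⟨hn, hd⟩ := num_den_of_det hq h
  obtain ⟨c, l, -, -, -, hh, hmin⟩ := exists_modInv_spec (a / q : ℚ)
  have := hmin b k hb (by rw [hn, hd]; exact h)
  have hq' : (0 : ℚ) < q := by exact_mod_cast hq
  refine ⟨div_pos (by exact_mod_cast ha) hq', (div_le_one hq').2 (by exact_mod_cast haq), ?_⟩
  rw [hh, hn, hd]; omega

theorem mem_saturatedFarey_of_det' {a q b k : ℤ} {Q : ℕ} (ha : 0 < a) (haq : a ≤ q)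
    (h : a * b - q * k = 1) (hQ : q + a + q ≤ Q) : (a / q : ℚ) ∈ saturatedFarey Q := by
  have hq : 0 < q := by omega
  obtain ⟨hn, hd⟩ := num_den_of_det hq h
  obtain ⟨c, l, hc, hcq, hcl, -, -⟩ := exists_modInv_spec (a / q : ℚ)
  rw [hn, hd] at hcl
  rw [hd] at hcq
  exact mem_saturatedFarey_of_det ha haq hc hcl (by omega)

theorem left_parent_bounds {a q b k : ℤ} (ha : 0 < a) (haq : a ≤ q) (hb : 0 < b) (hbq : b ≤ q)
    (h : a * b - q * k = 1) : 0 ≤ k ∧ k ≤ a ∧ k ≤ b := by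
  have hq : 0 < q := by omega
  refine ⟨?_, ?_, ?_⟩
  · by_contra hcon
    nlinarith [mul_pos ha hb]
  · by_contra hcon
    nlinarith
  · by_contra hcon
    nlinarith

theorem right_parent_bounds {a q b k : ℤ} (ha : 0 < a) (haq : a < q) (hbq : b ≤ q)
    (h : a * b - q * k = 1) : b < q ∧ 0 < a - k ∧ a - k ≤ q - b := by
  have hq : 0 < q := by omega
  have hbq' : b < q := by
    rcases hbq.lt_or_eq with hlt | heq
    · exact hlt
    · exfalso
      have : q ∣ 1 := ⟨a - k, by rw [← h, heq]; ring⟩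
      have := Int.le_of_dvd one_pos this
      omega
  refine ⟨hbq', ?_, ?_⟩
  · by_contra hcon
    nlinarith [mul_pos ha (sub_pos.2 hbq')]
  · by_contra hcon
    nlinarith [mul_pos (sub_pos.2 haq) (sub_pos.2 hbq')]

theorem eq_one_of_common_factor {a q b k u v D : ℤ} (hD : 0 < D) (h : a * b - q * k = 1)
    (hq : q = u * D) (ha : a = v * D) : D = 1 := by
  have hdvd : D ∣ 1 := ⟨v * b - u * k, by rw [← h, hq, ha]; ring⟩
  have := Int.le_of_dvd one_pos hdvd
  omega

/-! ### Structure of consecutive elements. -/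

/-- If the left parent of the larger of two fractions does not exceed the smaller one, and the
right parent of the smaller one is not below the larger one, then one of them is such a parent. -/
theorem det_eq_one_of_parents {a₁ q₁ b₁ k₁ a₂ q₂ b₂ k₂ : ℤ} (hq₁ : 0 < q₁) (hq₂ : 0 < q₂)
    (hb₁ : b₁ < q₁) (hb₂ : 0 < b₂) (hd₁ : a₁ * b₁ - q₁ * k₁ = 1) (hd₂ : a₂ * b₂ - q₂ * k₂ = 1)
    (hD : a₁ * q₂ < a₂ * q₁) (he : k₂ * q₁ ≤ a₁ * b₂)
    (hf : a₂ * (q₁ - b₁) ≤ (a₁ - k₁) * q₂) :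
    a₂ * q₁ - a₁ * q₂ = 1 ∧ (q₁ = b₂ ∨ q₂ = q₁ - b₁) := by
  -- With `D` the determinant, each fraction's vector is `D` times a parent of the other plus a
  -- nonnegative multiple (`e` or `f`) of the other. Both multiples positive would give `q₁ > q₂ >
  -- q₁`; a zero one makes `D` a common factor.
  have e1 : q₁ = b₂ * (a₂ * q₁ - a₁ * q₂) + q₂ * (a₁ * b₂ - k₂ * q₁) := by
    linear_combination (-q₁) * hd₂
  have e2 : a₁ = k₂ * (a₂ * q₁ - a₁ * q₂) + a₂ * (a₁ * b₂ - k₂ * q₁) := by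
    linear_combination (-a₁) * hd₂
  have e3 : q₂ = (q₁ - b₁) * (a₂ * q₁ - a₁ * q₂) + q₁ * ((a₁ - k₁) * q₂ - a₂ * (q₁ - b₁)) := by
    linear_combination (-q₂) * hd₁
  have e4 : a₂ = (a₁ - k₁) * (a₂ * q₁ - a₁ * q₂) +
      a₁ * ((a₁ - k₁) * q₂ - a₂ * (q₁ - b₁)) := by
    linear_combination (-a₂) * hd₁
  have hDpos : 0 < a₂ * q₁ - a₁ * q₂ := sub_pos.2 hD
  have he' : 0 ≤ a₁ * b₂ - k₂ * q₁ := sub_nonneg.2 he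
  have hf' : 0 ≤ (a₁ - k₁) * q₂ - a₂ * (q₁ - b₁) := sub_nonneg.2 hf
  generalize a₂ * q₁ - a₁ * q₂ = D at *
  generalize a₁ * b₂ - k₂ * q₁ = e at *
  generalize (a₁ - k₁) * q₂ - a₂ * (q₁ - b₁) = f at *
  rcases he'.lt_or_eq with he₀ | rfl
  · rcases hf'.lt_or_eq with hf₀ | rfl
    · exfalso
      have p1 : 0 < b₂ * D := mul_pos hb₂ hDpos
      have p2 : 0 < (q₁ - b₁) * D := mul_pos (sub_pos.2 hb₁) hDpos
      have p3 : q₂ ≤ q₂ * e := le_mul_of_one_le_right hq₂.le he₀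
      have p4 : q₁ ≤ q₁ * f := le_mul_of_one_le_right hq₁.le hf₀
      linarith
    · rw [mul_zero, add_zero] at e3 e4
      have hone := eq_one_of_common_factor hDpos hd₂ e3 e4
      rw [hone, mul_one] at e3
      exact ⟨hone, Or.inr e3⟩
  · rw [mul_zero, add_zero] at e1 e2
    have hone := eq_one_of_common_factor hDpos hd₁ e1 e2
    rw [hone, mul_one] at e1
    exact ⟨hone, Or.inl e1⟩

/-- Consecutive elements of `saturatedFarey Q` are Farey neighbours, one is a parent of the other,
and their mediant is not in `saturatedFarey Q`. -/
theorem consecutive_spec {Q : ℕ} {r₁ r₂ : ℚ} (h₁ : r₁ ∈ saturatedFarey Q)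
    (h₂ : r₂ ∈ saturatedFarey Q) (hlt : r₁ < r₂)
    (hcons : ∀ s ∈ saturatedFarey Q, ¬ (r₁ < s ∧ s < r₂)) :
    (Q : ℤ) < 2 * r₁.den + r₂.den + r₁.num + r₂.num ∧
    (((r₁.den : ℤ) < r₂.den ∧ r₂.den + r₂.num + r₁.den ≤ Q) ∨
     ((r₂.den : ℤ) < r₁.den ∧ 2 * r₁.den - r₂.den + r₁.num ≤ (Q : ℤ))) := by
  obtain ⟨hp₁, hle₁, hh₁⟩ := h₁
  obtain ⟨hp₂, hle₂, hh₂⟩ := h₂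
  obtain ⟨b₁, k₁, hb₁, hbq₁, hd₁, he₁, -⟩ := exists_modInv_spec r₁
  obtain ⟨b₂, k₂, hb₂, hbq₂, hd₂, he₂, -⟩ := exists_modInv_spec r₂
  rw [he₁] at hh₁
  rw [he₂] at hh₂
  have ha₁ : 0 < r₁.num := Rat.num_pos.2 hp₁
  have ha₂ : 0 < r₂.num := Rat.num_pos.2 hp₂
  have hlt1 : r₁ < 1 := lt_of_lt_of_le hlt hle₂
  have haq₁ : r₁.num < r₁.den := by
    have := (Rat.lt_iff _ _).1 hlt1
    simpa using this
  have haq₂ : r₂.num ≤ r₂.den := by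
    have := (Rat.le_iff _ _).1 hle₂
    simpa using this
  have hD := (Rat.lt_iff _ _).1 hlt
  have hr₁ : r₁ = (r₁.num : ℚ) / (r₁.den : ℤ) := by
    push_cast; exact (Rat.num_div_den r₁).symm
  have hr₂ : r₂ = (r₂.num : ℚ) / (r₂.den : ℤ) := by
    push_cast; exact (Rat.num_div_den r₂).symm
  have hq₁ : (0 : ℤ) < r₁.den := by exact_mod_cast r₁.den_pos
  have hq₂ : (0 : ℤ) < r₂.den := by exact_mod_cast r₂.den_pos
  generalize r₁.num = a₁ at *
  generalize (r₁.den : ℤ) = q₁ at *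
  generalize r₂.num = a₂ at *
  generalize (r₂.den : ℤ) = q₂ at *
  have hq₁' : (0 : ℚ) < q₁ := by exact_mod_cast hq₁
  have hq₂' : (0 : ℚ) < q₂ := by exact_mod_cast hq₂
  have key : ∀ a q : ℤ, 0 < q → (a / q : ℚ) ∈ saturatedFarey Q → a₁ * q < a * q₁ →
      a₂ * q ≤ a * q₂ := by
    intro a q hq hm hl
    have hq' : (0 : ℚ) < q := by exact_mod_cast hq
    by_contra hcon
    push Not at hcon
    refine hcons _ hm ⟨?_, ?_⟩
    · rw [hr₁, div_lt_div_iff₀ hq₁' hq']; exact_mod_cast hl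
    · rw [hr₂, div_lt_div_iff₀ hq' hq₂']; exact_mod_cast hcon
  obtain ⟨hk₂, hka, hkb⟩ := left_parent_bounds ha₂ haq₂ hb₂ hbq₂ hd₂
  obtain ⟨hk₁, -, -⟩ := left_parent_bounds ha₁ haq₁.le hb₁ hbq₁ hd₁
  obtain ⟨hb₁q, hak, hakq⟩ := right_parent_bounds ha₁ haq₁ hbq₁ hd₁
  have he : k₂ * q₁ ≤ a₁ * b₂ := by
    by_contra hcon
    push Not at hcon
    -- A left parent `0 / 1` is not in the set, but it cannot exceed the smaller fraction.
    have hk₂' : 0 < k₂ := pos_of_mul_pos_left ((mul_pos ha₁ hb₂).trans hcon) hq₁.le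
    have := key k₂ b₂ hb₂ (mem_saturatedFarey_of_det' (b := -q₂) (k := -a₂) hk₂' hkb
      (by linarith) (by omega)) hcon
    linarith
  have hf : a₂ * (q₁ - b₁) ≤ (a₁ - k₁) * q₂ :=
    key _ _ (by omega) (mem_saturatedFarey_of_det (b := b₁) (k := k₁) hak hakq hb₁
      (by linarith) (by omega)) (by linarith)
  obtain ⟨hdet, hpar⟩ := det_eq_one_of_parents hq₁ hq₂ hb₁q hb₂ hd₁ hd₂ hD he hf
  refine ⟨?_, ?_⟩
  · by_contra hcon
    have := key (a₁ + a₂) (q₁ + q₂) (by omega) (mem_saturatedFarey_of_det (b := q₁) (k := a₁)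
      (by omega) (by omega) hq₁ (by linarith) (by omega)) (by linarith)
    linarith
  · rcases hpar with hpar | hpar
    · refine Or.inl ⟨lt_of_le_of_ne (hpar ▸ hbq₂) fun heq => ?_, by omega⟩
      have : q₂ ∣ 1 := ⟨a₂ - k₂, by rw [← hd₂, ← hpar, heq]; ring⟩
      have := Int.le_of_dvd one_pos this
      omega
    · exact Or.inr ⟨by omega, by omega⟩

theorem num_le_den_of_mem {Q : ℕ} {r : ℚ} (h : r ∈ saturatedFarey Q) : r.num ≤ r.den := by
  simpa using (Rat.le_iff _ _).1 h.2.1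

theorem scaledDenomPairs_subset_regionV : scaledDenomPairs ⊆ regionV := by
  rintro _ ⟨Q, hQ, _, ⟨r₁, h₁, r₂, h₂, hlt, hcons, rfl⟩, rfl⟩
  obtain ⟨hm, hcase⟩ := consecutive_spec h₁ h₂ hlt hcons
  have n₁ := num_le_den_of_mem h₁
  have n₂ := num_le_den_of_mem h₂
  have ha₁ : 0 < r₁.num := Rat.num_pos.2 h₁.1
  have ha₂ : 0 < r₂.num := Rat.num_pos.2 h₂.1
  have hq₁ : (0 : ℤ) < r₁.den := by exact_mod_cast r₁.den_pos
  have hq₂ : (0 : ℤ) < r₂.den := by exact_mod_cast r₂.den_pos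
  have i1 : (Q : ℤ) ≤ 3 * r₁.den + 2 * r₂.den := by omega
  have i2 : (r₁.den : ℤ) ≤ Q := by omega
  have i3 : (r₂.den : ℤ) ≤ Q := by omega
  have i4 : 2 * (r₁.den : ℤ) - Q ≤ r₂.den := by omega
  have i5 : (r₂.den : ℤ) ≤ r₁.den ∨ (r₂.den : ℤ) ≤ Q - r₁.den := by omega
  have hQ' : (0 : ℝ) < Q := by exact_mod_cast (by omega : 0 < Q)
  have j1 : (Q : ℝ) ≤ 3 * r₁.den + 2 * r₂.den := by exact_mod_cast i1
  have j2 : (r₁.den : ℝ) ≤ Q := by exact_mod_cast i2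
  have j3 : (r₂.den : ℝ) ≤ Q := by exact_mod_cast i3
  have j4 : 2 * (r₁.den : ℝ) - Q ≤ r₂.den := by exact_mod_cast i4
  have j5 : (r₂.den : ℝ) ≤ r₁.den ∨ (r₂.den : ℝ) ≤ Q - r₁.den := by exact_mod_cast i5
  refine ⟨⟨by positivity, (div_le_one hQ').2 j2⟩, ⟨by positivity, (div_le_one hQ').2 j3⟩,
    max_le ?_ ?_, ?_⟩
  · have : (1 - 3 * ((r₁.den : ℝ) / Q)) / 2 = ((Q - 3 * r₁.den) / 2) / Q := by field_simp
    simp only [this]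
    exact div_le_div_of_nonneg_right (by linarith) hQ'.le
  · have : 2 * ((r₁.den : ℝ) / Q) - 1 = (2 * r₁.den - Q) / Q := by field_simp
    simp only [this]
    exact div_le_div_of_nonneg_right j4 hQ'.le
  · rcases j5 with h | h
    · exact le_max_of_le_left (div_le_div_of_nonneg_right h hQ'.le)
    · refine le_max_of_le_right ?_
      have : 1 - (r₁.den : ℝ) / Q = (Q - r₁.den) / Q := by field_simp
      simp only [this]
      exact div_le_div_of_nonneg_right h hQ'.le

/-! ### Density: realising pairs of neighbours. -/

/-- Farey neighbours in `saturatedFarey Q` whose mediant is too high are consecutive. -/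
theorem mem_denomPairs_of_det {Q : ℕ} {a₁ q₁ a₂ q₂ : ℤ} (hq₁ : 0 < q₁) (hq₂ : 0 < q₂)
    (hdet : a₂ * q₁ - a₁ * q₂ = 1) (h₁ : (a₁ / q₁ : ℚ) ∈ saturatedFarey Q)
    (h₂ : (a₂ / q₂ : ℚ) ∈ saturatedFarey Q) (hm : (Q : ℤ) < 2 * q₁ + q₂ + a₁ + a₂) :
    (q₁.toNat, q₂.toNat) ∈ denomPairs Q := by
  obtain ⟨hn₁, hd₁⟩ := num_den_of_det (a := a₁) (b := -q₂) (k := -a₂) hq₁ (by linarith)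
  obtain ⟨hn₂, hd₂⟩ := num_den_of_det (a := a₂) (b := q₁) (k := a₁) hq₂ (by linarith)
  have ha₁ : 0 < a₁ := by rw [← hn₁]; exact Rat.num_pos.2 h₁.1
  have ha₂ : 0 < a₂ := by rw [← hn₂]; exact Rat.num_pos.2 h₂.1
  refine ⟨_, h₁, _, h₂, ?_, ?_, ?_⟩
  · rw [Rat.lt_iff, hn₁, hd₁, hn₂, hd₂]; linarith
  · rintro s ⟨hs0, -, hsh⟩ ⟨hl, hr⟩
    obtain ⟨b, k, hb, -, hbk, he, -⟩ := exists_modInv_spec s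
    rw [he] at hsh
    rw [Rat.lt_iff, hn₁, hd₁] at hl
    rw [Rat.lt_iff, hn₂, hd₂] at hr
    generalize s.num = n at *
    generalize (s.den : ℤ) = d at *
    obtain ⟨α, hα⟩ : ∃ α, α = a₂ * d - n * q₂ := ⟨_, rfl⟩
    obtain ⟨β, hβ⟩ : ∃ β, β = n * q₁ - a₁ * d := ⟨_, rfl⟩
    obtain ⟨γ, hγ⟩ : ∃ γ, γ = a₂ * b - k * q₂ := ⟨_, rfl⟩
    obtain ⟨δ, hδ⟩ : ∃ δ, δ = k * q₁ - a₁ * b := ⟨_, rfl⟩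
    have hα1 : 1 ≤ α := by omega
    have hβ1 : 1 ≤ β := by omega
    have ed : d = α * q₁ + β * q₂ := by rw [hα, hβ]; linear_combination (-d) * hdet
    have en : n = α * a₁ + β * a₂ := by rw [hα, hβ]; linear_combination (-n) * hdet
    have eb : b = γ * q₁ + δ * q₂ := by rw [hγ, hδ]; linear_combination (-b) * hdet
    have eγ : γ * β - α * δ = 1 := by
      rw [hα, hβ, hγ, hδ]; linear_combination hbk + (n * b - d * k) * hdet
    -- Positivity of `b` forces `δ ≥ 0` and `γ ≥ 1`, hence `b ≥ q₁`; with `α, β ≥ 1` the height of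
    -- `s` is at least that of the mediant.
    have hδ0 : 0 ≤ δ := by
      by_contra hcon
      have : γ ≤ 0 := by
        by_contra h
        nlinarith
      nlinarith
    have hγ1 : 1 ≤ γ := by
      by_contra h
      nlinarith [mul_nonneg (by omega : 0 ≤ α) hδ0]
    nlinarith
  · ext <;> simp only <;> omega

/-- A pair of sequences of Farey neighbours with prescribed limiting direction. -/
theorem exists_neighbours_tendsto (ρ t : ℚ) (x : ℝ) (hx : 0 < x) :
    ∃ q₁ a₁ q₂ a₂ : ℕ → ℤ, (∀ Q, a₂ Q * q₁ Q - a₁ Q * q₂ Q = 1) ∧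
      Tendsto (fun Q : ℕ => (q₁ Q : ℝ) / Q) atTop (𝓝 x) ∧
      Tendsto (fun Q : ℕ => (a₁ Q : ℝ) / Q) atTop (𝓝 (t * x)) ∧
      Tendsto (fun Q : ℕ => (q₂ Q : ℝ) / Q) atTop (𝓝 (ρ * x)) ∧
      Tendsto (fun Q : ℕ => (a₂ Q : ℝ) / Q) atTop (𝓝 (t * (ρ * x))) := by
  obtain ⟨n', m', hA⟩ : ∃ n' m' : ℤ, (ρ.den : ℤ) * n' - ρ.num * m' = 1 := by
    obtain ⟨b, k, -, -, h, -⟩ := exists_modInv_spec ρ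
    exact ⟨-k, -b, by linarith⟩
  obtain ⟨a', q', hB⟩ : ∃ a' q' : ℤ, (t.den : ℤ) * a' - t.num * q' = 1 := by
    obtain ⟨b, k, -, -, h, -⟩ := exists_modInv_spec t
    exact ⟨-k, -b, by linarith⟩
  have hρ : (ρ : ℝ) = ρ.num / (ρ.den : ℤ) := by push_cast; exact Rat.cast_def ρ
  have ht : (t : ℝ) = t.num / (t.den : ℤ) := by push_cast; exact Rat.cast_def t
  have hm : (0 : ℤ) < ρ.den := by exact_mod_cast ρ.den_pos
  have hq : (0 : ℤ) < t.den := by exact_mod_cast t.den_pos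
  rw [hρ, ht]
  generalize (ρ.den : ℤ) = m at *
  generalize ρ.num = n at *
  generalize (t.den : ℤ) = q at *
  generalize t.num = a at *
  have hm' : (0 : ℝ) < m := by exact_mod_cast hm
  have hq' : (0 : ℝ) < q := by exact_mod_cast hq
  set c : ℝ := x / (m * q) with hc
  have hc0 : 0 ≤ c := by positivity
  have hK : Tendsto (fun Q : ℕ => (⌊c * Q⌋₊ : ℝ) / Q) atTop (𝓝 c) :=
    (tendsto_nat_floor_mul_div_atTop hc0).comp tendsto_natCast_atTop_atTop
  have lim : ∀ u v : ℤ, Tendsto (fun Q : ℕ => (((⌊c * Q⌋₊ : ℤ) * u + v : ℤ) : ℝ) / Q) atTop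
      (𝓝 (c * u)) := by
    intro u v
    have := (hK.mul_const (u : ℝ)).add (tendsto_const_div_atTop_nhds_zero_nat (v : ℝ))
    rw [add_zero] at this
    refine this.congr fun Q => ?_
    push_cast
    ring
  -- With `K = ⌊c * Q⌋₊`, these are the entries of the product `[m m'; n n'] [K -1; 1 0] [q a; q'
  -- a']` of determinant-one matrices.
  refine ⟨fun Q => (⌊c * Q⌋₊ : ℤ) * (m * q) + (m' * q - m * q'),
    fun Q => (⌊c * Q⌋₊ : ℤ) * (m * a) + (m' * a - m * a'),
    fun Q => (⌊c * Q⌋₊ : ℤ) * (n * q) + (n' * q - n * q'),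
    fun Q => (⌊c * Q⌋₊ : ℤ) * (n * a) + (n' * a - n * a'), ?_, ?_, ?_, ?_, ?_⟩
  · intro Q
    linear_combination (q * a' - a * q') * hA + hB
  · convert lim (m * q) (m' * q - m * q') using 2
    rw [hc]; push_cast; field_simp
  · convert lim (m * a) (m' * a - m * a') using 2
    rw [hc]; push_cast; field_simp
  · convert lim (n * q) (n' * q - n * q') using 2
    rw [hc]; push_cast; field_simp
  · convert lim (n * a) (n' * a - n * a') using 2
    rw [hc]; push_cast; field_simp

theorem eventually_lt_of_tendsto_div {f g : ℕ → ℤ} {u v : ℝ}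
    (hf : Tendsto (fun Q : ℕ => (f Q : ℝ) / Q) atTop (𝓝 u))
    (hg : Tendsto (fun Q : ℕ => (g Q : ℝ) / Q) atTop (𝓝 v)) (h : u < v) :
    ∀ᶠ Q in atTop, f Q < g Q := by
  filter_upwards [hf.eventually_lt hg h, eventually_gt_atTop 0] with Q hQ hpos
  have hpos' : (0 : ℝ) < Q := by exact_mod_cast hpos
  rw [div_lt_div_iff_of_pos_right hpos'] at hQ
  exact_mod_cast hQ

theorem mem_closure_of_slope {ρ t : ℚ} {x y : ℝ} (hx : 0 < x) (hy : 0 < y) (hρ : (ρ : ℝ) * x = y)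
    (ht0 : (0 : ℝ) < t) (ht1 : (t : ℝ) < 1) (hm : 1 < 2 * x + y + t * x + t * y)
    (h : (y < x ∧ 2 * x - y + t * x < 1) ∨ (x < y ∧ x + y + t * y < 1)) :
    (x, y) ∈ closure scaledDenomPairs := by
  obtain ⟨q₁, a₁, q₂, a₂, hdet, l1, l2, l3, l4⟩ := exists_neighbours_tendsto ρ t x hx
  rw [hρ] at l3 l4
  have l0 : Tendsto (fun Q : ℕ => ((0 : ℤ) : ℝ) / Q) atTop (𝓝 0) := by simp
  have lQ : Tendsto (fun Q : ℕ => ((Q : ℤ) : ℝ) / Q) atTop (𝓝 1) := by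
    refine tendsto_const_nhds.congr' ?_
    filter_upwards [eventually_gt_atTop 0] with Q hQ
    have : (Q : ℝ) ≠ 0 := by exact_mod_cast hQ.ne'
    push_cast
    field_simp
  have hmem : ∀ᶠ Q : ℕ in atTop, ((q₁ Q : ℝ) / Q, (q₂ Q : ℝ) / Q) ∈ scaledDenomPairs := by
    have lin : ∀ i j k l : ℤ, Tendsto (fun Q : ℕ =>
        ((i * q₁ Q + j * q₂ Q + k * a₁ Q + l * a₂ Q : ℤ) : ℝ) / Q) atTop
        (𝓝 (i * x + j * y + k * (t * x) + l * (t * y))) := by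
      intro i j k l
      refine ((((l1.const_mul (i : ℝ)).add (l3.const_mul (j : ℝ))).add
        (l2.const_mul (k : ℝ))).add (l4.const_mul (l : ℝ))).congr fun Q => ?_
      push_cast
      ring
    have p1 := eventually_lt_of_tendsto_div l0 l1 hx
    have p2 := eventually_lt_of_tendsto_div l0 l3 hy
    have p3 := eventually_lt_of_tendsto_div l0 l2 (mul_pos ht0 hx)
    have p4 := eventually_lt_of_tendsto_div l0 l4 (mul_pos ht0 hy)
    have p5 := eventually_lt_of_tendsto_div l2 l1 (by nlinarith)
    have p6 := eventually_lt_of_tendsto_div l4 l3 (by nlinarith)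
    have p7 := eventually_lt_of_tendsto_div lQ (lin 2 1 1 1) (by push_cast; linarith)
    have fin : ∀ Q : ℕ, 3 ≤ Q → 0 < q₁ Q → 0 < q₂ Q →
        (a₁ Q / q₁ Q : ℚ) ∈ saturatedFarey Q → (a₂ Q / q₂ Q : ℚ) ∈ saturatedFarey Q →
        (Q : ℤ) < 2 * q₁ Q + q₂ Q + a₁ Q + a₂ Q →
        ((q₁ Q : ℝ) / Q, (q₂ Q : ℝ) / Q) ∈ scaledDenomPairs := by
      intro Q h3 h1 h2 m1 m2 hm
      refine ⟨Q, h3, _, mem_denomPairs_of_det h1 h2 (hdet Q) m1 m2 hm, ?_⟩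
      have c1 : ((q₁ Q).toNat : ℝ) = q₁ Q := by exact_mod_cast Int.toNat_of_nonneg h1.le
      have c2 : ((q₂ Q).toNat : ℝ) = q₂ Q := by exact_mod_cast Int.toNat_of_nonneg h2.le
      simp only [c1, c2]
    rcases h with ⟨hyx, h⟩ | ⟨hxy, h⟩
    · have p8 := eventually_lt_of_tendsto_div l3 l1 hyx
      have p9 := eventually_lt_of_tendsto_div (lin 2 (-1) 1 0) lQ (by push_cast; linarith)
      have p10 := eventually_lt_of_tendsto_div (lin 1 0 0 1) lQ (by push_cast; nlinarith)
      filter_upwards [p1, p2, p3, p4, p5, p6, p7, p8, p9, p10, eventually_ge_atTop 3] with Q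
        p1 p2 p3 p4 p5 p6 p7 p8 p9 p10 h3
      have hd := hdet Q
      refine fin Q h3 p1 p2 (mem_saturatedFarey_of_det (b := q₁ Q - q₂ Q) (k := a₁ Q - a₂ Q)
        p3 p5.le (by omega) (by linarith) (by omega)) (mem_saturatedFarey_of_det
        (b := q₁ Q - q₂ Q) (k := a₁ Q - a₂ Q) p4 p6.le (by omega) (by linarith) (by omega))
        (by omega)
    · have p8 := eventually_lt_of_tendsto_div l1 l3 hxy
      have p9 := eventually_lt_of_tendsto_div (lin 1 1 0 1) lQ (by push_cast; linarith)
      have p10 := eventually_lt_of_tendsto_div (lin 2 0 1 0) lQ (by push_cast; nlinarith)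
      filter_upwards [p1, p2, p3, p4, p5, p6, p7, p8, p9, p10, eventually_ge_atTop 3] with Q
        p1 p2 p3 p4 p5 p6 p7 p8 p9 p10 h3
      have hd := hdet Q
      refine fin Q h3 p1 p2 (mem_saturatedFarey_of_det' (b := -q₂ Q) (k := -a₂ Q)
        p3 p5.le (by linarith) (by omega)) (mem_saturatedFarey_of_det
        (b := q₁ Q) (k := a₁ Q) p4 p6.le p1 (by linarith) (by omega))
        (by omega)
  exact mem_closure_of_tendsto (l1.prodMk_nhds l3) hmem

/-! ### Interiors of the two halves of the region, and passage to the closure. -/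

def lowerInterior : Set (ℝ × ℝ) :=
  {z | 0 < z.2 ∧ z.2 < z.1 ∧ 2 * z.1 - z.2 < 1 ∧ 1 < 3 * z.1 + 2 * z.2}

def upperInterior : Set (ℝ × ℝ) :=
  {z | 0 < z.1 ∧ z.1 < z.2 ∧ z.1 + z.2 < 1 ∧ 1 < 3 * z.1 + 2 * z.2}

theorem isOpen_lowerInterior : IsOpen lowerInterior := by
  simp only [lowerInterior, Set.ofPred_and]
  exact (isOpen_lt (by fun_prop) (by fun_prop)).inter <|
    (isOpen_lt (by fun_prop) (by fun_prop)).inter <|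
    (isOpen_lt (by fun_prop) (by fun_prop)).inter (isOpen_lt (by fun_prop) (by fun_prop))

theorem isOpen_upperInterior : IsOpen upperInterior := by
  simp only [upperInterior, Set.ofPred_and]
  exact (isOpen_lt (by fun_prop) (by fun_prop)).inter <|
    (isOpen_lt (by fun_prop) (by fun_prop)).inter <|
    (isOpen_lt (by fun_prop) (by fun_prop)).inter (isOpen_lt (by fun_prop) (by fun_prop))

theorem rat_mem_closure {x y : ℚ} (h : ((x : ℝ), (y : ℝ)) ∈ lowerInterior ∪ upperInterior) :
    ((x : ℝ), (y : ℝ)) ∈ closure scaledDenomPairs := by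
  have hx : (0 : ℝ) < x := by
    rcases h with h | h
    · exact h.1.trans h.2.1
    · exact h.1
  have hy : (0 : ℝ) < y := by
    rcases h with h | h
    · exact h.1
    · exact h.1.trans h.2.1
  have hρ : ((y / x : ℚ) : ℝ) * x = y := by push_cast; field_simp
  have hxy : (0 : ℝ) < x + y := by positivity
  generalize y / x = ρ at hρ
  generalize (x : ℝ) = x at *
  generalize (y : ℝ) = y at *
  rcases h with ⟨-, h2, h3, h4⟩ | ⟨-, h2, h3, h4⟩ <;> simp only at h2 h3 h4
  -- The bounds on `t` are the mediant condition and the larger height condition; the defining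
  -- inequalities make the interval nonempty.
  · obtain ⟨t, ht, ht'⟩ := exists_rat_btwn (show max 0 ((1 - 2 * x - y) / (x + y)) <
      min 1 ((1 - 2 * x + y) / x) by
        rw [max_lt_iff, lt_min_iff, lt_min_iff, div_lt_one hxy, div_lt_div_iff₀ hxy hx]
        refine ⟨⟨one_pos, div_pos (by linarith) hx⟩, by linarith, by nlinarith⟩)
    rw [max_lt_iff, div_lt_iff₀ hxy] at ht
    rw [lt_min_iff, lt_div_iff₀ hx] at ht'
    exact mem_closure_of_slope hx hy hρ ht.1 ht'.1 (by linarith) (Or.inl ⟨h2, by linarith⟩)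
  · obtain ⟨t, ht, ht'⟩ := exists_rat_btwn (show max 0 ((1 - 2 * x - y) / (x + y)) <
      min 1 ((1 - x - y) / y) by
        rw [max_lt_iff, lt_min_iff, lt_min_iff, div_lt_one hxy, div_lt_div_iff₀ hxy hy]
        refine ⟨⟨one_pos, div_pos (by linarith) hy⟩, by linarith, by nlinarith⟩)
    rw [max_lt_iff, div_lt_iff₀ hxy] at ht
    rw [lt_min_iff, lt_div_iff₀ hy] at ht'
    exact mem_closure_of_slope hx hy hρ ht.1 ht'.1 (by linarith) (Or.inr ⟨h2, by linarith⟩)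

theorem interiors_subset_closure :
    lowerInterior ∪ upperInterior ⊆ closure scaledDenomPairs := by
  have hd : Dense (Set.range (Prod.map ((↑) : ℚ → ℝ) ((↑) : ℚ → ℝ))) :=
    Rat.denseRange_cast.prodMap Rat.denseRange_cast
  refine (hd.open_subset_closure_inter
    (isOpen_lowerInterior.union isOpen_upperInterior)).trans ?_
  refine closure_minimal ?_ isClosed_closure
  rintro _ ⟨hz, ⟨x, y⟩, rfl⟩
  exact rat_mem_closure hz

theorem mem_closure_of_segment {s : Set (ℝ × ℝ)} {x y : ℝ} (c d : ℝ)
    (h : ∀ ε : ℝ, 0 < ε → ε < 1 → (x + ε * (c - x), y + ε * (d - y)) ∈ s) :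
    (x, y) ∈ closure s := by
  have hcont : Continuous fun ε : ℝ => (x + ε * (c - x), y + ε * (d - y)) := by fun_prop
  have ht : Tendsto (fun ε : ℝ => (x + ε * (c - x), y + ε * (d - y))) (𝓝[>] 0) (𝓝 (x, y)) := by
    have := (hcont.tendsto 0).mono_left (nhdsWithin_le_nhds (s := Set.Ioi 0))
    simpa using this
  refine mem_closure_of_tendsto ht ?_
  filter_upwards [Ioo_mem_nhdsGT (zero_lt_one' ℝ)] with ε hε
  exact h ε hε.1 hε.2

theorem regionV_subset_closure_interiors :
    regionV ⊆ closure (lowerInterior ∪ upperInterior) := by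
  rintro ⟨x, y⟩ ⟨⟨hx0, hx1⟩, ⟨hy0, hy1⟩, hl, hu⟩
  simp only [max_le_iff] at hx0 hx1 hy0 hy1 hl hu
  obtain ⟨hl1, hl2⟩ := hl
  by_cases hyx : y ≤ x
  -- Any interior point would do as the far end: each half is convex.
  · refine closure_mono Set.subset_union_left (mem_closure_of_segment (3 / 5) (2 / 5) ?_)
    intro ε h0 h1
    refine ⟨?_, ?_, ?_, ?_⟩ <;> simp only <;> nlinarith
  · have hyx' : y ≤ 1 - x := (le_max_iff.1 hu).resolve_left hyx
    refine closure_mono Set.subset_union_right (mem_closure_of_segment (2 / 5) (1 / 2) ?_)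
    intro ε h0 h1
    refine ⟨?_, ?_, ?_, ?_⟩ <;> simp only <;> nlinarith

theorem theorem1 : scaledDenomPairs ⊆ regionV ∧ regionV ⊆ closure scaledDenomPairs :=
  ⟨scaledDenomPairs_subset_regionV, regionV_subset_closure_interiors.trans
    (closure_minimal interiors_subset_closure isClosed_closure)⟩
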